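/- Let $K$ be a field and let $S=K[x_1,\ldots,x_n]$ with its $\mathbb{Z}^n$-grading. Let $I\subset U$ be monomial ideals of $S$ ($U=S$ is allowed) such that $U/I$ is a Cohen--Macaulay $S$-module of dimension $2$, and suppose that $I$ is reduced, i.e. $\sqrt{I}=I$ (equivalently, $I$ is generated by squarefree monomials). Then the multigraded $S$-module $M=U/I$ is clean: there is a chain $0=M_0\subset M_1\subset\cdots\subset M_r=M$ of multigraded submodules of $M$ such that for each $i=1,\ldots,r$ there are a monomial prime ideal $P_i$ of $S$ and $a_i\in\mathbb{N}^n$ with $M_i/M_{i-1}\cong (S/P_i)(-a_i)$ as multigraded modules, and $\{P_1,\ldots,P_r\}=\operatorname{Min}(M)$, the set of minimal primes of $M$, that is, the prime ideals minimal over $\operatorname{Ann}_S(M)$. Here $U/I$ Cohen--Macaulay of dimension $2$ means that $\operatorname{depth} U/I=\dim U/I=2$, where depth is the maximal length of a $U/I$-regular sequence in $(x_1,\ldots,x_n)$ and $\dim$ is the Krull dimension. -/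

import Mathlib

namespace Multigraded

open MvPolynomial

/-- The polynomial ring `S = K[x_1, …, x_n]`. -/
abbrev Poly (K : Type*) [Field K] (n : ℕ) : Type _ := MvPolynomial (Fin n) K

/-- A monomial ideal: an ideal generated by a set of monomials. -/
def IsMonomialIdeal {K : Type*} [Field K] {n : ℕ} (I : Ideal (Poly K n)) : Prop :=
  ∃ A : Set (Fin n →₀ ℕ), I = Ideal.span ((fun a => monomial a (1 : K)) '' A)

section Gradings

variable {K : Type*} [Field K] {n : ℕ}
variable {M : Type*} [AddCommGroup M] [Module (Poly K n) M]

/-- The `ℤⁿ`-grading of the polynomial ring: the component of degree `a` is `K · x^a`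
(and is zero if `a` has a negative entry). -/
noncomputable def polyGrading (K : Type*) [Field K] (n : ℕ)
    (a : Fin n → ℤ) : AddSubgroup (Poly K n) where
  carrier := {f | ∀ m ∈ f.support, ∀ i, (m i : ℤ) = a i}
  zero_mem' := by simp
  add_mem' := by
    intro f g hf hg m hm
    rcases Finset.mem_union.1 (support_add hm) with h | h
    · exact hf m h
    · exact hg m h
  neg_mem' := by
    intro f hf m hm
    rw [support_neg] at hm
    exact hf m hm

/-- The grading induced on a submodule: `L_a = L ∩ M_a`. -/
noncomputable def subGrading (gr : (Fin n → ℤ) → AddSubgroup M) (L : Submodule (Poly K n) M)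
    (a : Fin n → ℤ) : AddSubgroup L :=
  (gr a).comap L.subtype.toAddMonoidHom

/-- The grading induced on a quotient: `(M / L)_a` is the image of `M_a`. -/
noncomputable def quotGrading (gr : (Fin n → ℤ) → AddSubgroup M) (L : Submodule (Poly K n) M)
    (a : Fin n → ℤ) : AddSubgroup (M ⧸ L) :=
  (gr a).map L.mkQ.toAddMonoidHom

/-- The grading of the shifted module `M(-a)`: `M(-a)_b = M_{b - a}`. -/
def shiftGrading (gr : (Fin n → ℤ) → AddSubgroup M) (a b : Fin n → ℤ) : AddSubgroup M :=
  gr (b - a)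

/-- Isomorphism of multigraded modules: an `S`-linear isomorphism that carries the component
of each degree onto the component of the same degree. -/
def GradedIso (K : Type*) [Field K] {n : ℕ} {M : Type*} [AddCommGroup M] [Module (Poly K n) M]
    {N : Type*} [AddCommGroup N] [Module (Poly K n) N]
    (gr : (Fin n → ℤ) → AddSubgroup M) (gr' : (Fin n → ℤ) → AddSubgroup N) : Prop :=
  ∃ e : M ≃ₗ[Poly K n] N, ∀ a, (gr a).map e.toLinearMap.toAddMonoidHom = gr' a

/-- A multigraded submodule: one generated by its homogeneous elements. -/
def IsGradedSubmodule (gr : (Fin n → ℤ) → AddSubgroup M) (L : Submodule (Poly K n) M) : Prop :=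
  L = Submodule.span (Poly K n) {x | x ∈ L ∧ ∃ a, x ∈ gr a}

/-- The chain `0 = M_0 ⊆ M_1 ⊆ … ⊆ M_r = M` of multigraded submodules is a prime filtration with
primes `P_1, …, P_r`: there are `a_i ∈ ℕⁿ` with `M_i / M_{i-1} ≅ S / P_i (-a_i)` as multigraded
modules, where each `P_i` is a monomial prime ideal. -/
structure IsPrimeFiltration (gr : (Fin n → ℤ) → AddSubgroup M) {r : ℕ}
    (F : Fin (r + 1) → Submodule (Poly K n) M) (P : Fin r → Ideal (Poly K n)) : Prop where
  zero : F 0 = ⊥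
  last : F (Fin.last r) = ⊤
  le : ∀ i : Fin r, F i.castSucc ≤ F i.succ
  graded : ∀ i, IsGradedSubmodule gr (F i)
  prime : ∀ i, (P i).IsPrime
  monomial : ∀ i, IsMonomialIdeal (P i)
  iso : ∀ i : Fin r, ∃ a : Fin n → ℕ,
    GradedIso K (quotGrading (subGrading gr (F i.succ)) ((F i.castSucc).submoduleOf (F i.succ)))
      (shiftGrading (quotGrading (polyGrading K n) (P i)) (fun j => (a j : ℤ)))

/-- A multigraded module `M` is clean if it has a prime filtration whose support
`{P_1, …, P_r}` is the set `Min(M)` of minimal primes of `M`. -/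
def IsClean (K : Type*) [Field K] {n : ℕ} {M : Type*} [AddCommGroup M] [Module (Poly K n) M]
    (gr : (Fin n → ℤ) → AddSubgroup M) : Prop :=
  ∃ (r : ℕ) (F : Fin (r + 1) → Submodule (Poly K n) M) (P : Fin r → Ideal (Poly K n)),
    IsPrimeFiltration gr F P ∧
      Set.range P = (Module.annihilator (Poly K n) M).minimalPrimes

end Gradings

/-- The depth of an `S`-module `M`: the supremum of the lengths of the `M`-regular sequences
in the graded maximal ideal `(x_1, …, x_n)`. -/
noncomputable def depth (K : Type*) [Field K] (n : ℕ) (M : Type*) [AddCommGroup M]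
    [Module (Poly K n) M] : ℕ∞ :=
  ⨆ rs : {rs : List (Poly K n) //
    (∀ f ∈ rs, f ∈ idealOfVars (Fin n) K) ∧ RingTheory.Sequence.IsRegular M rs},
    (rs.1.length : ℕ∞)

/-- A finitely generated multigraded `S`-module `M` is Cohen-Macaulay if it is zero or if
`depth M = dim M`. -/
def IsCohenMacaulay (K : Type*) [Field K] (n : ℕ) (M : Type*) [AddCommGroup M]
    [Module (Poly K n) M] : Prop :=
  Subsingleton M ∨ (depth K n M : WithBot ℕ∞) = Module.supportDim (Poly K n) M

section Subquotient

variable {K : Type*} [Field K] {n : ℕ}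

/-- The `S`-module `U / I`, for ideals `I ⊆ U` of `S`. -/
abbrev Subquotient (I U : Ideal (Poly K n)) : Type _ := U ⧸ I.submoduleOf U

/-- The multigrading of `U / I` induced by the one of `S`. -/
noncomputable def subquotientGrading (I U : Ideal (Poly K n)) :
    (Fin n → ℤ) → AddSubgroup (Subquotient I U) :=
  quotGrading (subGrading (polyGrading K n) U) (I.submoduleOf U)

end Subquotient

end Multigraded

/-! Since `I` is radical, membership of a monomial in `I` depends only on its support. Let the
facets be the maximal supports of monomials in `U` outside `I`. Then `U/I` embeds in the product of
the `S/P_F` over the facets `F`, and the `P_F` are exactly the minimal primes of `U/I`.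

Put the facets in order and intersect `U` with the `P_e` of the facets placed so far. Placing one
more facet `e` cuts out a quotient `S/P_e(-a)` as soon as the monomials of `U` supported in `e`, but
in no facet placed before, are all multiples of one of them, `x^a`. So cleanness reduces to a
shelling: some remaining facet always has such a least monomial (`exists_isLeast_newExponents`).

Depth 2 enters through gluing (`glues_of_forall_X_pow`): a family modulo the `P_F` that comes from
`U` after multiplication by a power of each variable already comes from `U`. For constant monomial
families this is a saturation property of `U`; for indicator families it is connectedness. With
dimension 2, all facets are edges of a graph, and the shelling is built vertex by vertex from these
two properties. -/

namespace Multigraded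

open MvPolynomial

/-! ### Monomial ideals and the primes generated by variables -/

section MonomialIdeals

variable {K : Type*} [Field K] {n : ℕ}

theorem IsMonomialIdeal.mem_iff {I : Ideal (Poly K n)} (hI : IsMonomialIdeal I)
    {f : Poly K n} : f ∈ I ↔ ∀ m ∈ f.support, monomial m (1 : K) ∈ I := by
  obtain ⟨A, rfl⟩ := hI
  rw [mem_ideal_span_monomial_image]
  refine forall₂_congr fun m _ => ?_
  rw [mem_ideal_span_monomial_image]
  simp

theorem monomial_mem_of_le {I : Ideal (Poly K n)} {a b : Fin n →₀ ℕ} (hab : a ≤ b)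
    (ha : monomial a (1 : K) ∈ I) : monomial b (1 : K) ∈ I := by
  have : monomial b (1 : K) = monomial (b - a) 1 * monomial a 1 := by
    rw [monomial_mul, tsub_add_cancel_of_le hab, one_mul]
  rw [this]
  exact I.mul_mem_left _ ha

theorem monomial_mem_of_monomial_one_mem {I : Ideal (Poly K n)} {a : Fin n →₀ ℕ} (c : K)
    (ha : monomial a (1 : K) ∈ I) : monomial a c ∈ I := by
  have : monomial a c = C c * monomial a 1 := by rw [C_mul_monomial, mul_one]
  rw [this]
  exact I.mul_mem_left _ ha

theorem monomial_mem_of_support_subset {I : Ideal (Poly K n)} (hI : I.IsRadical)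
    {a b : Fin n →₀ ℕ} (hab : b.support ⊆ a.support) (hb : monomial b (1 : K) ∈ I) :
    monomial a (1 : K) ∈ I := by
  apply hI
  -- Each `a i` is at least 1 on the support of `b`, so `b.degree * a i` dominates `b i`.
  refine ⟨b.degree, ?_⟩
  rw [monomial_pow, one_pow]
  refine monomial_mem_of_le (fun i => ?_) hb
  by_cases hi : b i = 0
  · simp [hi]
  · have h1 : a i ≠ 0 := Finsupp.mem_support_iff.1 (hab (Finsupp.mem_support_iff.2 hi))
    have h2 : b i ≤ b.degree := Finsupp.le_degree i b
    simp only [Finsupp.smul_apply, smul_eq_mul]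
    nlinarith [Nat.one_le_iff_ne_zero.2 h1]

/-- The monomial prime ideal generated by the variables outside `F`. -/
noncomputable def facePrime (K : Type*) [Field K] {n : ℕ} (F : Finset (Fin n)) : Ideal (Poly K n) :=
  Ideal.span (X '' {i | i ∉ F})

theorem mem_facePrime {F : Finset (Fin n)} {f : Poly K n} :
    f ∈ facePrime K F ↔ ∀ m ∈ f.support, ¬ m.support ⊆ F := by
  rw [facePrime, mem_ideal_span_X_image]
  refine forall₂_congr fun m _ => ?_
  simp only [Finset.not_subset, Finsupp.mem_support_iff, Set.mem_ofPred_eq]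
  exact exists_congr fun i => and_comm

theorem coeff_eq_zero_of_mem_facePrime {F : Finset (Fin n)} {f : Poly K n}
    (hf : f ∈ facePrime K F) {m : Fin n →₀ ℕ} (hm : m.support ⊆ F) : coeff m f = 0 := by
  by_contra h
  exact mem_facePrime.1 hf m (mem_support_iff.2 h) hm

theorem monomial_mem_facePrime {F : Finset (Fin n)} {m : Fin n →₀ ℕ} :
    monomial m (1 : K) ∈ facePrime K F ↔ ¬ m.support ⊆ F := by
  rw [mem_facePrime]
  simp

theorem isMonomialIdeal_facePrime (F : Finset (Fin n)) : IsMonomialIdeal (facePrime K F) := by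
  refine ⟨(fun i => Finsupp.single i 1) '' {i | i ∉ F}, ?_⟩
  rw [Set.image_image]
  rfl

theorem facePrime_le_facePrime_iff {F G : Finset (Fin n)} :
    facePrime K F ≤ facePrime K G ↔ G ⊆ F := by
  constructor
  · intro h i hi
    by_contra hF
    have h1 : (X i : Poly K n) ∈ facePrime K F := Ideal.subset_span ⟨i, hF, rfl⟩
    have h2 := coeff_eq_zero_of_mem_facePrime (h h1) (m := Finsupp.single i 1)
      ((Finsupp.support_single_subset).trans (by simpa using hi))
    simp at h2
  · intro h f hf
    exact mem_facePrime.2 fun m hm hmG => mem_facePrime.1 hf m hm (hmG.trans h)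

/-- The projection `K[x_1, …, x_n] → K[x_i : i ∈ F]` that kills the variables outside `F`. -/
noncomputable def faceProj (K : Type*) [Field K] {n : ℕ} (F : Finset (Fin n)) :
    Poly K n →ₐ[K] MvPolynomial F K :=
  aeval fun i => if h : i ∈ F then X ⟨i, h⟩ else 0

theorem faceProj_rename (F : Finset (Fin n)) (p : MvPolynomial F K) :
    faceProj K F (rename (fun i : F => (i : Fin n)) p) = p := by
  have : (faceProj K F).comp (rename (fun i : F => (i : Fin n))) = AlgHom.id K _ := by
    ext i
    simp [faceProj]
  exact DFunLike.congr_fun this p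

theorem sub_rename_faceProj_mem (F : Finset (Fin n)) (f : Poly K n) :
    f - rename (fun i : F => (i : Fin n)) (faceProj K F f) ∈ facePrime K F := by
  rw [← Ideal.Quotient.eq]
  have : Ideal.Quotient.mkₐ K (facePrime K F) =
      ((Ideal.Quotient.mkₐ K (facePrime K F)).comp
        (rename (fun i : F => (i : Fin n)))).comp (faceProj K F) := by
    ext i
    by_cases h : i ∈ F
    · simp [faceProj, h]
    · have h1 : (X i : Poly K n) ∈ facePrime K F := Ideal.subset_span ⟨i, h, rfl⟩
      simp [faceProj, h, Ideal.Quotient.eq_zero_iff_mem.2 h1]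
  exact DFunLike.congr_fun this f

theorem ker_faceProj (F : Finset (Fin n)) :
    RingHom.ker (faceProj K F) = facePrime K F := by
  apply le_antisymm
  · intro f hf
    have := sub_rename_faceProj_mem F f
    rwa [(RingHom.mem_ker).1 hf, map_zero, sub_zero] at this
  · rw [facePrime, Ideal.span_le]
    rintro _ ⟨i, hi, rfl⟩
    have hi' : i ∉ F := hi
    simp [RingHom.mem_ker, faceProj, hi']

instance isPrime_facePrime (F : Finset (Fin n)) : (facePrime K F).IsPrime := by
  rw [← ker_faceProj]
  exact RingHom.ker_isPrime _

theorem card_le_ringKrullDim {J : Ideal (Poly K n)} {F : Finset (Fin n)}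
    (h : J ≤ facePrime K F) : (F.card : WithBot ℕ∞) ≤ ringKrullDim (Poly K n ⧸ J) := by
  have h1 : ringKrullDim (MvPolynomial F K) = F.card := by
    rw [MvPolynomial.ringKrullDim_of_isNoetherianRing]
    simp
  rw [← h1]
  refine ringKrullDim_le_of_surjective
    (Ideal.Quotient.lift J (faceProj K F).toRingHom fun f hf => ?_) ?_
  · have := h hf
    rw [← ker_faceProj] at this
    exact this
  · refine Ideal.Quotient.lift_surjective_of_surjective _ _ fun p => ⟨_, faceProj_rename F p⟩

theorem ringKrullDim_le_card {J : Ideal (Poly K n)} {F : Finset (Fin n)}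
    (h : facePrime K F ≤ J) : ringKrullDim (Poly K n ⧸ J) ≤ F.card := by
  have h1 : ringKrullDim (MvPolynomial F K) = F.card := by
    rw [MvPolynomial.ringKrullDim_of_isNoetherianRing]
    simp
  rw [← h1]
  refine ringKrullDim_le_of_surjective
    ((Ideal.Quotient.mk J).comp (rename (fun i : F => (i : Fin n))).toRingHom) fun y => ?_
  obtain ⟨f, rfl⟩ := Ideal.Quotient.mk_surjective y
  refine ⟨faceProj K F f, ?_⟩
  exact (Ideal.Quotient.eq.2 (h (sub_rename_faceProj_mem F f))).symm

end MonomialIdeals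

/-! ### Facets and minimal primes -/

section MaxFaces

variable {K : Type*} [Field K] {n : ℕ}

/-- The maximal supports of the monomials in `U` that do not lie in `I`. -/
def maxFaces (I U : Ideal (Poly K n)) : Set (Finset (Fin n)) :=
  {F | Maximal (fun F => ∃ a : Fin n →₀ ℕ, a.support = F ∧ monomial a (1 : K) ∈ U ∧
    monomial a (1 : K) ∉ I) F}

variable {I U : Ideal (Poly K n)}

theorem mem_maxFaces {F : Finset (Fin n)} : F ∈ maxFaces I U ↔
    Maximal (fun F => ∃ a : Fin n →₀ ℕ, a.support = F ∧ monomial a (1 : K) ∈ U ∧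
      monomial a (1 : K) ∉ I) F :=
  Iff.rfl

theorem exists_mem_maxFaces {a : Fin n →₀ ℕ} (haU : monomial a (1 : K) ∈ U)
    (haI : monomial a (1 : K) ∉ I) : ∃ F ∈ maxFaces I U, a.support ⊆ F := by
  obtain ⟨F, h1, h2⟩ := Finite.exists_le_maximal
    (p := fun F => ∃ a : Fin n →₀ ℕ, a.support = F ∧ monomial a (1 : K) ∈ U ∧
      monomial a (1 : K) ∉ I) (a := a.support) ⟨a, rfl, haU, haI⟩
  exact ⟨F, h2, h1⟩

theorem eq_of_subset_of_mem_maxFaces {F G : Finset (Fin n)} (hF : F ∈ maxFaces I U)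
    (hG : G ∈ maxFaces I U) (h : F ⊆ G) : F = G :=
  (mem_maxFaces.1 hF).eq_of_le (mem_maxFaces.1 hG).prop h

theorem monomial_notMem_of_subset (hI : I.IsRadical) {F : Finset (Fin n)}
    (hF : F ∈ maxFaces I U) {a : Fin n →₀ ℕ} (ha : a.support ⊆ F) :
    monomial a (1 : K) ∉ I := by
  obtain ⟨b, rfl, -, hb⟩ := (mem_maxFaces.1 hF).prop
  exact fun h => hb (monomial_mem_of_support_subset hI ha h)

theorem le_facePrime (hI : IsMonomialIdeal I) (hrad : I.IsRadical) {F : Finset (Fin n)}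
    (hF : F ∈ maxFaces I U) : I ≤ facePrime K F := fun _ hf =>
  mem_facePrime.2 fun m hm h => monomial_notMem_of_subset hrad hF h (hI.mem_iff.1 hf m hm)

/-- A monomial of `U` outside `I` has its support in some facet, hence survives modulo that prime.
This is the injectivity of `U/I` into the product of the `S/P_F`. -/
theorem mem_of_forall_mem_facePrime (hI : IsMonomialIdeal I) (hU : IsMonomialIdeal U)
    {f : Poly K n} (hf : f ∈ U) (h : ∀ F ∈ maxFaces I U, f ∈ facePrime K F) : f ∈ I := by
  rw [hI.mem_iff]
  intro m hm
  by_contra hmI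
  obtain ⟨F, hF, hmF⟩ := exists_mem_maxFaces (hU.mem_iff.1 hf m hm) hmI
  exact mem_facePrime.1 (h F hF) m hm hmF

theorem mem_facePrime_of_forall_mul_mem (hI : IsMonomialIdeal I) (hrad : I.IsRadical)
    {r : Poly K n} (h : ∀ u ∈ U, r * u ∈ I) {F : Finset (Fin n)} (hF : F ∈ maxFaces I U) :
    r ∈ facePrime K F := by
  obtain ⟨a, ha, haU, -⟩ := (mem_maxFaces.1 hF).prop
  have h1 := le_facePrime hI hrad hF (h _ haU)
  refine ((isPrime_facePrime F).mem_or_mem h1).resolve_right fun h2 => ?_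
  exact monomial_mem_facePrime.1 h2 ha.subset

theorem mul_mem_of_forall_mem_facePrime (hI : IsMonomialIdeal I) (hU : IsMonomialIdeal U)
    {r : Poly K n} (h : ∀ F ∈ maxFaces I U, r ∈ facePrime K F) {u : Poly K n} (hu : u ∈ U) :
    r * u ∈ I :=
  mem_of_forall_mem_facePrime hI hU (U.mul_mem_left _ hu) fun F hF =>
    Ideal.mul_mem_right _ _ (h F hF)

theorem mem_annihilator_subquotient {r : Poly K n} :
    r ∈ Module.annihilator (Poly K n) (Subquotient I U) ↔ ∀ u ∈ U, r * u ∈ I := by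
  rw [Module.mem_annihilator]
  constructor
  · intro h u hu
    have := h (Submodule.Quotient.mk ⟨u, hu⟩)
    rw [← Submodule.Quotient.mk_smul, Submodule.Quotient.mk_eq_zero] at this
    exact this
  · intro h m
    obtain ⟨⟨u, hu⟩, rfl⟩ := Submodule.Quotient.mk_surjective _ m
    rw [← Submodule.Quotient.mk_smul, Submodule.Quotient.mk_eq_zero]
    exact h u hu

theorem annihilator_subquotient (hI : IsMonomialIdeal I) (hU : IsMonomialIdeal U)
    (hrad : I.IsRadical) {r : Poly K n} :
    r ∈ Module.annihilator (Poly K n) (Subquotient I U) ↔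
      ∀ F ∈ maxFaces I U, r ∈ facePrime K F := by
  rw [mem_annihilator_subquotient]
  exact ⟨fun h F hF => mem_facePrime_of_forall_mul_mem hI hrad h hF,
    fun h u hu => mul_mem_of_forall_mem_facePrime hI hU h hu⟩

/-- The annihilator is the finite intersection of the `P_F`, so a prime above it contains some
`P_F`; facets form an antichain, so none of these is redundant. -/
theorem minimalPrimes_annihilator_subquotient (hI : IsMonomialIdeal I)
    (hU : IsMonomialIdeal U) (hrad : I.IsRadical) :
    (Module.annihilator (Poly K n) (Subquotient I U)).minimalPrimes =
      facePrime K '' maxFaces I U := by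
  have key : ∀ Q : Ideal (Poly K n), Q.IsPrime →
      Module.annihilator (Poly K n) (Subquotient I U) ≤ Q →
      ∃ F ∈ maxFaces I U, facePrime K F ≤ Q := by
    intro Q hQ hle
    have hfin : (maxFaces I U).Finite := Set.toFinite _
    have : hfin.toFinset.inf (facePrime K) ≤ Q := by
      intro r hr
      apply hle
      rw [annihilator_subquotient hI hU hrad]
      intro F hF
      exact (Finset.inf_le (hfin.mem_toFinset.2 hF) : _ ≤ facePrime K F) hr
    obtain ⟨F, hF, h⟩ := (Ideal.IsPrime.inf_le' hQ).1 this
    exact ⟨F, hfin.mem_toFinset.1 hF, h⟩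
  have hann : ∀ F ∈ maxFaces I U,
      Module.annihilator (Poly K n) (Subquotient I U) ≤ facePrime K F := fun F hF r hr =>
    (annihilator_subquotient hI hU hrad).1 hr F hF
  ext Q
  constructor
  · rintro ⟨⟨hQ, hle⟩, hmin⟩
    obtain ⟨F, hF, hFQ⟩ := key Q hQ hle
    exact ⟨F, hF, le_antisymm hFQ (hmin ⟨isPrime_facePrime F, hann F hF⟩ hFQ)⟩
  · rintro ⟨F, hF, rfl⟩
    refine ⟨⟨isPrime_facePrime F, hann F hF⟩, ?_⟩
    rintro Q ⟨hQ, hle⟩ hQF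
    obtain ⟨G, hG, hGQ⟩ := key Q hQ hle
    have := eq_of_subset_of_mem_maxFaces hF hG (facePrime_le_facePrime_iff.1 (hGQ.trans hQF))
    exact this ▸ hGQ

end MaxFaces

/-! ### From an ordering of the facets to a prime filtration -/

section Filtration

variable {K : Type*} [Field K] {n : ℕ}

theorem sum_monomial_mem {W : Ideal (Poly K n)} {f : Poly K n}
    (h : ∀ m ∈ f.support, monomial m (1 : K) ∈ W) : f ∈ W := by
  rw [f.as_sum]
  exact W.sum_mem fun m hm => monomial_mem_of_monomial_one_mem _ (h m hm)

theorem monomial_mem_polyGrading {a : Fin n → ℤ} {m : Fin n →₀ ℕ} (c : K)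
    (h : ∀ i, (m i : ℤ) = a i) : monomial m c ∈ polyGrading K n a := by
  intro m' hm'
  have := Finset.mem_singleton.1 (support_monomial_subset hm')
  rw [this]
  exact h

theorem eq_monomial_of_mem_polyGrading {a : Fin n → ℤ} {f : Poly K n}
    (hf : f ∈ polyGrading K n a) {m : Fin n →₀ ℕ} (hm : m ∈ f.support) :
    f = monomial m (coeff m f) := by
  have : f.support = {m} := by
    refine Finset.eq_singleton_iff_unique_mem.2 ⟨hm, fun m' hm' => ?_⟩
    ext i
    exact_mod_cast (hf m' hm' i).trans (hf m hm i).symm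
  conv_lhs => rw [f.as_sum, this, Finset.sum_singleton]

/-- The submodule `V / I` of `U / I`. -/
noncomputable def subquotientSubmodule (I U V : Ideal (Poly K n)) :
    Submodule (Poly K n) (Subquotient I U) :=
  (V.submoduleOf U).map (I.submoduleOf U).mkQ

variable {I U V V' : Ideal (Poly K n)}

theorem mk_mem_subquotientSubmodule (hIV : I ≤ V) {u : U} :
    (I.submoduleOf U).mkQ u ∈ subquotientSubmodule I U V ↔ (u : Poly K n) ∈ V := by
  constructor
  · rintro ⟨v, hv, h⟩
    have h1 : (v : Poly K n) - u ∈ I := (Submodule.Quotient.eq (I.submoduleOf U)).1 h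
    have h2 : (v : Poly K n) ∈ V := hv
    simpa using V.sub_mem h2 (hIV h1)
  · intro h
    exact ⟨u, h, rfl⟩

theorem subquotientSubmodule_mono (h : V' ≤ V) :
    subquotientSubmodule I U V' ≤ subquotientSubmodule I U V :=
  Submodule.map_mono (Submodule.comap_mono h)

theorem isGradedSubmodule_subquotientSubmodule (hV : IsMonomialIdeal V) (hVU : V ≤ U) :
    IsGradedSubmodule (subquotientGrading I U) (subquotientSubmodule I U V) := by
  refine le_antisymm ?_ (Submodule.span_le.2 fun x hx => hx.1)
  set W := Submodule.span (Poly K n) {x | x ∈ subquotientSubmodule I U V ∧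
    ∃ a, x ∈ subquotientGrading I U a} with hW
  have key : V ≤ (W.comap (I.submoduleOf U).mkQ).map U.subtype := by
    intro f hf
    refine sum_monomial_mem (W := (W.comap (I.submoduleOf U).mkQ).map U.subtype) fun m hm => ?_
    have hmV := hV.mem_iff.1 hf m hm
    refine ⟨⟨monomial m 1, hVU hmV⟩, Submodule.subset_span ⟨⟨_, hmV, rfl⟩, fun i => m i, ?_⟩, rfl⟩
    exact ⟨_, monomial_mem_polyGrading 1 fun i => rfl, rfl⟩
  rintro _ ⟨v, hv, rfl⟩
  obtain ⟨v', h, h'⟩ := key (show (v : Poly K n) ∈ V from hv)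
  have : v' = v := Subtype.ext h'
  exact this ▸ h

/-- Every monomial of `V` outside `V'` is a multiple of `x^a`, so `V/V'` is cyclic on the class of
`x^a`, whose annihilator is `P`. -/
theorem gradedIso_subquotientSubmodule {P : Ideal (Poly K n)} (hV : IsMonomialIdeal V)
    (hIV' : I ≤ V') (hV'V : V' ≤ V) (hVU : V ≤ U) {a : Fin n →₀ ℕ}
    (ha : monomial a (1 : K) ∈ V) (hP : ∀ s, s * monomial a (1 : K) ∈ V' ↔ s ∈ P)
    (hle : ∀ b, monomial b (1 : K) ∈ V → monomial b (1 : K) ∈ V' ∨ a ≤ b) :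
    GradedIso K
      (quotGrading (subGrading (subquotientGrading I U) (subquotientSubmodule I U V))
        ((subquotientSubmodule I U V').submoduleOf (subquotientSubmodule I U V)))
      (shiftGrading (quotGrading (polyGrading K n) P) (fun j => ((a j : ℕ) : ℤ))) := by
  set F := subquotientSubmodule I U V
  set F' := subquotientSubmodule I U V'
  have hIV := hIV'.trans hV'V
  let γ₀ : U := ⟨monomial a 1, hVU ha⟩
  let γ : F := ⟨(I.submoduleOf U).mkQ γ₀, (mk_mem_subquotientSubmodule hIV).2 ha⟩
  let ψ : Poly K n →ₗ[Poly K n] (F ⧸ F'.submoduleOf F) :=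
    (F'.submoduleOf F).mkQ.comp (LinearMap.toSpanSingleton (Poly K n) F γ)
  have hψ : ∀ (s : Poly K n) (u : U) (hu : (u : Poly K n) ∈ V),
      ψ s = (F'.submoduleOf F).mkQ ⟨(I.submoduleOf U).mkQ u,
        (mk_mem_subquotientSubmodule hIV).2 hu⟩ ↔
      s * monomial a 1 - (u : Poly K n) ∈ V' := by
    intro s u hu
    have h1 := mk_mem_subquotientSubmodule (u := s • γ₀ - u) hIV'
    refine Iff.trans ?_ h1
    exact Submodule.Quotient.eq (F'.submoduleOf F)
  have hker : LinearMap.ker ψ = P := by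
    ext s
    rw [LinearMap.mem_ker, ← hP]
    have := hψ s 0 V.zero_mem
    simp only [ZeroMemClass.coe_zero, sub_zero] at this
    rw [← this]
    rfl
  have hrep : ∀ y : F ⧸ F'.submoduleOf F, ∃ (u : U) (hu : (u : Poly K n) ∈ V),
      y = (F'.submoduleOf F).mkQ ⟨(I.submoduleOf U).mkQ u,
        (mk_mem_subquotientSubmodule hIV).2 hu⟩ := by
    intro y
    obtain ⟨⟨x, hx⟩, rfl⟩ := Submodule.mkQ_surjective _ y
    obtain ⟨u, rfl⟩ := Submodule.mkQ_surjective _ x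
    exact ⟨u, (mk_mem_subquotientSubmodule hIV).1 hx, rfl⟩
  have hsurj : Function.Surjective ψ := by
    intro y
    obtain ⟨u, hu, rfl⟩ := hrep y
    have : V ≤ V' ⊔ Ideal.span {monomial a (1 : K)} := by
      intro f hf
      refine sum_monomial_mem fun m hm => ?_
      rcases hle m (hV.mem_iff.1 hf m hm) with h | h
      · exact Ideal.mem_sup_left h
      · exact Ideal.mem_sup_right (monomial_mem_of_le h (Ideal.mem_span_singleton_self _))
    obtain ⟨w, hw, t, ht, hwt⟩ := Submodule.mem_sup.1 (this hu)
    obtain ⟨s, rfl⟩ := Ideal.mem_span_singleton'.1 ht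
    refine ⟨s, (hψ s u hu).2 ?_⟩
    rw [← hwt]
    simpa using hw
  let e : (Poly K n ⧸ P) ≃ₗ[Poly K n] (F ⧸ F'.submoduleOf F) :=
    (Submodule.quotEquivOfEq _ _ hker.symm).trans (ψ.quotKerEquivOfSurjective hsurj)
  have he : ∀ s, e (P.mkQ s) = ψ s := fun s => rfl
  refine ⟨e.symm, fun b => ?_⟩
  ext y
  constructor
  · rintro ⟨x, ⟨⟨q, hq⟩, ⟨u, hu, hu'⟩, rfl⟩, rfl⟩
    obtain rfl : (I.submoduleOf U).mkQ u = q := hu'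
    have huV : (u : Poly K n) ∈ V := (mk_mem_subquotientSubmodule hIV).1 hq
    have hub : (u : Poly K n) ∈ polyGrading K n b := hu
    suffices h : ∃ s ∈ polyGrading K n (b - fun j => ((a j : ℕ) : ℤ)),
        s * monomial a 1 - (u : Poly K n) ∈ V' by
      obtain ⟨s, hs, hsu⟩ := h
      refine ⟨s, hs, ?_⟩
      refine (e.symm_apply_eq.2 ?_).symm
      exact (((he s).trans ((hψ s u huV).2 hsu))).symm
    -- A homogeneous `u` outside `V'` is a scalar times a single monomial, which is then divisible
    -- by `x^a`.
    by_cases huV' : (u : Poly K n) ∈ V'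
    · refine ⟨0, zero_mem _, ?_⟩
      simpa using huV'
    · have h0 : (u : Poly K n) ≠ 0 := fun h => huV' (h ▸ V'.zero_mem)
      obtain ⟨m, hm⟩ := Finset.nonempty_of_ne_empty (mt support_eq_empty.1 h0)
      have hum := eq_monomial_of_mem_polyGrading hub hm
      have ham : a ≤ m := by
        refine (hle m (hV.mem_iff.1 huV m hm)).resolve_left fun h => huV' ?_
        rw [hum]
        exact monomial_mem_of_monomial_one_mem _ h
      refine ⟨monomial (m - a) (coeff m (u : Poly K n)), ?_, ?_⟩
      · refine monomial_mem_polyGrading _ fun i => ?_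
        have h1 := hub m hm i
        have h2 := ham i
        simp only [Finsupp.coe_tsub, Pi.sub_apply]
        omega
      · rw [monomial_mul, tsub_add_cancel_of_le ham, mul_one, ← hum, sub_self]
        exact V'.zero_mem
  · rintro ⟨s, hs, rfl⟩
    have hsV : s * monomial a (1 : K) ∈ V := V.mul_mem_left _ ha
    refine ⟨ψ s, ⟨⟨(I.submoduleOf U).mkQ ⟨s * monomial a 1, hVU hsV⟩,
      (mk_mem_subquotientSubmodule hIV).2 hsV⟩, ⟨_, ?_, rfl⟩, ?_⟩, ?_⟩
    · intro m hm i
      obtain ⟨m', hm', m'', hm'', rfl⟩ := Finset.mem_add.1 (support_mul _ _ hm)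
      have h1 := hs m' hm' i
      have h2 := Finset.mem_singleton.1 (support_monomial_subset hm'')
      subst h2
      simp only [Pi.sub_apply] at h1
      simp only [Finsupp.add_apply]
      push_cast
      omega
    · refine ((hψ s _ hsV).2 ?_).symm
      simp
    · exact e.symm_apply_eq.2 (he s).symm

/-- The exponents of the monomials in `U` whose support lies in `e`, but in no member of `L`. -/
def newExponents (U : Ideal (Poly K n)) (e : Finset (Fin n)) (L : List (Finset (Fin n))) :
    Set (Fin n →₀ ℕ) :=
  {a | monomial a (1 : K) ∈ U ∧ a.support ⊆ e ∧ ∀ e' ∈ L, ¬ a.support ⊆ e'}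

/-- The ideal `U ∩ ⋂_{e ∈ L} P_e`. -/
noncomputable def faceInter (U : Ideal (Poly K n)) (L : List (Finset (Fin n))) : Ideal (Poly K n) where
  carrier := {f | f ∈ U ∧ ∀ e ∈ L, f ∈ facePrime K e}
  zero_mem' := ⟨U.zero_mem, fun e _ => (facePrime K e).zero_mem⟩
  add_mem' := fun hf hg => ⟨U.add_mem hf.1 hg.1, fun e he => add_mem (hf.2 e he) (hg.2 e he)⟩
  smul_mem' := fun c _ hf =>
    ⟨U.mul_mem_left c hf.1, fun e he => Ideal.mul_mem_left _ c (hf.2 e he)⟩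

theorem isMonomialIdeal_of_forall_monomial {J : Ideal (Poly K n)}
    (h : ∀ f ∈ J, ∀ m ∈ f.support, monomial m (1 : K) ∈ J) : IsMonomialIdeal J := by
  refine ⟨{m | monomial m (1 : K) ∈ J}, le_antisymm (fun f hf => ?_) ?_⟩
  · exact sum_monomial_mem fun m hm => Ideal.subset_span ⟨m, h f hf m hm, rfl⟩
  · rw [Ideal.span_le]
    rintro _ ⟨m, hm, rfl⟩
    exact hm

theorem isMonomialIdeal_faceInter (hU : IsMonomialIdeal U) (L : List (Finset (Fin n))) :
    IsMonomialIdeal (faceInter U L) := by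
  refine isMonomialIdeal_of_forall_monomial fun f hf m hm => ?_
  exact ⟨hU.mem_iff.1 hf.1 m hm, fun e he =>
    (isMonomialIdeal_facePrime e).mem_iff.1 (hf.2 e he) m hm⟩

/-- The list is read from its end: `L.drop (k + 1)` holds the facets placed before `L[k]`, and the
full list leaves only `I`. The monomials lost on adding `L[k]` are those in `newExponents`, so their
least element generates the `k`-th quotient. -/
theorem isPrimeFiltration_faceInter (hI : IsMonomialIdeal I) (hU : IsMonomialIdeal U)
    (hrad : I.IsRadical) (hIU : I ≤ U) {L : List (Finset (Fin n))}
    (hL : ∀ e, e ∈ L ↔ e ∈ maxFaces I U)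
    (hleast : ∀ (k : ℕ) (hk : k < L.length),
      ∃ a, IsLeast (newExponents U L[k] (L.drop (k + 1))) a) :
    IsPrimeFiltration (subquotientGrading I U)
      (fun k : Fin (L.length + 1) => subquotientSubmodule I U (faceInter U (L.drop k)))
      (fun k : Fin L.length => facePrime K L[k]) where
  zero := by
    rw [eq_bot_iff]
    rintro _ ⟨v, hv, rfl⟩
    have hv' : (v : Poly K n) ∈ faceInter U L := hv
    refine (Submodule.Quotient.mk_eq_zero _).2 ?_
    exact mem_of_forall_mem_facePrime hI hU hv'.1 fun F hF => hv'.2 F ((hL F).2 hF)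
  last := by
    rw [eq_top_iff]
    rintro x -
    obtain ⟨u, rfl⟩ := Submodule.mkQ_surjective _ x
    refine ⟨u, ⟨u.2, ?_⟩, rfl⟩
    simp
  le := fun k => subquotientSubmodule_mono fun f hf =>
    ⟨hf.1, fun e he => hf.2 e (List.drop_subset_drop_left L (Nat.le_succ _) he)⟩
  graded := fun k => isGradedSubmodule_subquotientSubmodule
    (isMonomialIdeal_faceInter hU _) fun f hf => hf.1
  prime := fun k => isPrime_facePrime _
  monomial := fun k => isMonomialIdeal_facePrime _
  iso := by
    intro k
    obtain ⟨a, ⟨haU, hae, haL⟩, hmin⟩ := hleast k k.2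
    have hdrop : L.drop k = L[k] :: L.drop (k + 1) := List.drop_eq_getElem_cons k.2
    refine ⟨a, gradedIso_subquotientSubmodule (a := a) (isMonomialIdeal_faceInter hU _) ?_ ?_
      (fun f hf => hf.1) ⟨haU, fun e he => monomial_mem_facePrime.2 (haL e he)⟩ ?_ ?_⟩
    · exact fun f hf => ⟨hIU hf, fun e he =>
        le_facePrime hI hrad ((hL e).1 (List.mem_of_mem_drop he)) hf⟩
    · exact fun f hf =>
        ⟨hf.1, fun e he => hf.2 e (List.drop_subset_drop_left L (Nat.le_succ _) he)⟩
    · intro s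
      constructor
      · intro h
        have h1 := h.2 L[k] (by rw [Fin.val_castSucc, hdrop]; exact List.mem_cons_self)
        exact ((isPrime_facePrime _).mem_or_mem h1).resolve_right fun h2 =>
          monomial_mem_facePrime.1 h2 hae
      · intro h
        refine ⟨U.mul_mem_left _ haU, fun e he => ?_⟩
        simp only [Fin.val_castSucc, hdrop, List.mem_cons] at he
        rcases he with rfl | he
        · exact Ideal.mul_mem_right _ _ h
        · exact Ideal.mul_mem_left _ _ (monomial_mem_facePrime.2 (haL e he))
    · intro b hb
      by_cases hbe : b.support ⊆ L[k]
      · exact Or.inr (hmin ⟨hb.1, hbe, fun e he => monomial_mem_facePrime.1 (hb.2 e he)⟩)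
      · refine Or.inl ⟨hb.1, fun e he => ?_⟩
        simp only [Fin.val_castSucc, hdrop, List.mem_cons] at he
        rcases he with rfl | he
        · exact monomial_mem_facePrime.2 hbe
        · exact hb.2 e he

end Filtration

/-! ### Depth two as a gluing property -/

section Depth

variable {K : Type*} [Field K] {n : ℕ} {I U : Ideal (Poly K n)}

/-- There are `f, g ∈ (x_1, …, x_n)` that form a weakly regular sequence on `U / I`, expressed in
terms of elements of `U`. -/
def HasRegularPair (I U : Ideal (Poly K n)) : Prop :=
  ∃ f ∈ idealOfVars (Fin n) K, ∃ g ∈ idealOfVars (Fin n) K,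
    (∀ u ∈ U, f * u ∈ I → u ∈ I) ∧
    ∀ u ∈ U, ∀ v ∈ U, g * u - f * v ∈ I → ∃ w ∈ U, u - f * w ∈ I

theorem hasRegularPair_of_depth_eq_two (h : depth K n (Subquotient I U) = 2) :
    HasRegularPair I U := by
  have hex : ∃ rs : {rs : List (Poly K n) // (∀ f ∈ rs, f ∈ idealOfVars (Fin n) K) ∧
      RingTheory.Sequence.IsRegular (Subquotient I U) rs}, 1 < (rs.1.length : ℕ∞) := by
    apply lt_iSup_iff.1
    rw [depth] at h
    rw [h]
    norm_num
  obtain ⟨⟨rs, hrs, hreg⟩, hlen⟩ := hex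
  match rs, hrs, hreg, hlen with
  | [], _, _, hlen => simp at hlen
  | [f], _, _, hlen => simp at hlen
  | f :: g :: t, hrs, hreg, _ =>
    rw [RingTheory.Sequence.isRegular_cons_iff, RingTheory.Sequence.isRegular_cons_iff] at hreg
    obtain ⟨hf, hg, -⟩ := hreg
    refine ⟨f, hrs f (by simp), g, hrs g (by simp), fun u hu hfu => ?_, fun u hu v hv huv => ?_⟩
    · have h1 : f • (I.submoduleOf U).mkQ ⟨u, hu⟩ = 0 := by
        rw [← map_smul]
        exact (Submodule.Quotient.mk_eq_zero _).2 hfu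
      have h2 : (I.submoduleOf U).mkQ ⟨u, hu⟩ = 0 := hf (by simpa using h1)
      exact (Submodule.Quotient.mk_eq_zero (I.submoduleOf U)).1 h2
    · set x : Subquotient I U := (I.submoduleOf U).mkQ ⟨u, hu⟩ with hx
      set y : Subquotient I U := (I.submoduleOf U).mkQ ⟨v, hv⟩ with hy
      have h1 : g • x = f • y := by
        rw [hx, hy, ← map_smul, ← map_smul]
        exact (Submodule.Quotient.eq (I.submoduleOf U)).2 huv
      have h2 : (Submodule.Quotient.mk x : QuotSMulTop f (Subquotient I U)) = 0 := by
        apply hg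
        simp only [smul_zero]
        rw [← Submodule.Quotient.mk_smul, Submodule.Quotient.mk_eq_zero, h1]
        exact Submodule.smul_mem_pointwise_smul _ _ _ trivial
      rw [Submodule.Quotient.mk_eq_zero, Submodule.mem_smul_pointwise_iff_exists] at h2
      obtain ⟨z, -, hz⟩ := h2
      obtain ⟨⟨w, hw⟩, rfl⟩ := Submodule.mkQ_surjective _ z
      refine ⟨w, hw, ?_⟩
      rw [hx, ← map_smul] at hz
      exact (Submodule.Quotient.eq (I.submoduleOf U)).1 hz.symm

/-- The family `z` of polynomials, taken modulo the primes `P_F` with `F ∈ maxFaces I U`, comes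
from a single element of `U`. -/
def Glues (I U : Ideal (Poly K n)) (z : Finset (Fin n) → Poly K n) : Prop :=
  ∃ u ∈ U, ∀ F ∈ maxFaces I U, u - z F ∈ facePrime K F

/-- The polynomials `r` for which `r z` comes from an element of `U`. -/
def glueIdeal (I U : Ideal (Poly K n)) (z : Finset (Fin n) → Poly K n) : Ideal (Poly K n) where
  carrier := {r | Glues I U fun F => r * z F}
  zero_mem' := ⟨0, U.zero_mem, fun F _ => by simp⟩
  add_mem' := by
    rintro r s ⟨u, hu, hu'⟩ ⟨v, hv, hv'⟩
    refine ⟨u + v, U.add_mem hu hv, fun F hF => ?_⟩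
    have : u + v - (r + s) * z F = (u - r * z F) + (v - s * z F) := by ring
    rw [this]
    exact add_mem (hu' F hF) (hv' F hF)
  smul_mem' := by
    rintro c r ⟨u, hu, hu'⟩
    refine ⟨c * u, U.mul_mem_left _ hu, fun F hF => ?_⟩
    have : c * u - c • r * z F = c * (u - r * z F) := by rw [smul_eq_mul]; ring
    rw [this]
    exact Ideal.mul_mem_left _ _ (hu' F hF)

theorem mem_glueIdeal {z : Finset (Fin n) → Poly K n} {r : Poly K n} :
    r ∈ glueIdeal I U z ↔ Glues I U fun F => r * z F :=
  Iff.rfl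

/-- A monomial of `U` with support exactly `F` lies in every other `P_G`; if `f` were in `P_F`, it
would kill this nonzero class. -/
theorem notMem_facePrime_of_regular (hI : IsMonomialIdeal I) (hU : IsMonomialIdeal U)
    {f : Poly K n} (hf : ∀ u ∈ U, f * u ∈ I → u ∈ I) {F : Finset (Fin n)}
    (hF : F ∈ maxFaces I U) : f ∉ facePrime K F := by
  intro hfF
  obtain ⟨a, rfl, haU, haI⟩ := (mem_maxFaces.1 hF).prop
  refine haI (hf _ haU (mem_of_forall_mem_facePrime hI hU (U.mul_mem_left _ haU) fun G hG => ?_))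
  by_cases h : a.support ⊆ G
  · rw [← eq_of_subset_of_mem_maxFaces hF hG h]
    exact Ideal.mul_mem_right _ _ hfF
  · exact Ideal.mul_mem_left _ _ (monomial_mem_facePrime.2 h)

/-- If `f z` and `g z` come from `u` and `v`, then `g u = f v` modulo `I`, so regularity gives `u =
f w` modulo `I`. Cancelling `f` modulo each `P_F` shows that `w` glues `z`. -/
theorem glues_of_forall_mem_idealOfVars (hI : IsMonomialIdeal I) (hU : IsMonomialIdeal U)
    (hrad : I.IsRadical) (hreg : HasRegularPair I U)
    {z : Finset (Fin n) → Poly K n} (h : idealOfVars (Fin n) K ≤ glueIdeal I U z) :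
    Glues I U z := by
  obtain ⟨f, hf, g, hg, h1, h2⟩ := hreg
  obtain ⟨u, hu, hu'⟩ := mem_glueIdeal.1 (h hf)
  obtain ⟨v, hv, hv'⟩ := mem_glueIdeal.1 (h hg)
  obtain ⟨w, hw, huw⟩ := h2 u hu v hv <| by
    refine mem_of_forall_mem_facePrime hI hU
      (sub_mem (U.mul_mem_left _ hu) (U.mul_mem_left _ hv)) fun F hF => ?_
    have : g * u - f * v = g * (u - f * z F) - f * (v - g * z F) := by ring
    rw [this]
    exact sub_mem (Ideal.mul_mem_left _ _ (hu' F hF)) (Ideal.mul_mem_left _ _ (hv' F hF))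
  refine ⟨w, hw, fun F hF => ?_⟩
  have h3 : f * (w - z F) ∈ facePrime K F := by
    have : f * (w - z F) = (u - f * z F) - (u - f * w) := by ring
    rw [this]
    exact sub_mem (hu' F hF) (le_facePrime hI hrad hF huw)
  exact ((isPrime_facePrime F).mem_or_mem h3).resolve_left
    (notMem_facePrime_of_regular hI hU h1 hF)

theorem glues_of_forall_X_pow (hI : IsMonomialIdeal I) (hU : IsMonomialIdeal U)
    (hrad : I.IsRadical) (hreg : HasRegularPair I U)
    {z : Finset (Fin n) → Poly K n} (h : ∀ k, ∃ N, Glues I U fun F => X k ^ N * z F) :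
    Glues I U z := by
  have h1 : idealOfVars (Fin n) K ≤ (glueIdeal I U z).radical := by
    rw [Ideal.span_le]
    rintro _ ⟨k, rfl⟩
    obtain ⟨N, hN⟩ := h k
    exact Ideal.mem_radical_iff.2 ⟨N, hN⟩
  obtain ⟨t, ht⟩ :=
    Ideal.exists_pow_le_of_le_radical_of_fg h1 (idealOfVars_fg (Fin n) K)
  -- Powers of the maximal ideal are removed one at a time, by gluing `r z` for each `r` in the next
  -- lower power.
  have key : ∀ t, idealOfVars (Fin n) K ^ t ≤ glueIdeal I U z → Glues I U z := by
    intro t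
    induction t with
    | zero =>
      intro ht
      have : (1 : Poly K n) ∈ glueIdeal I U z := ht (by simp)
      simpa [mem_glueIdeal] using this
    | succ t ih =>
      intro ht
      refine ih fun r hr => ?_
      refine glues_of_forall_mem_idealOfVars hI hU hrad hreg fun s hs => ?_
      have : s * r ∈ glueIdeal I U z := by
        apply ht
        rw [pow_succ']
        exact Ideal.mul_mem_mul hs hr
      simpa [mem_glueIdeal, mul_assoc] using this
  exact key t ht

theorem X_pow_mem_facePrime {F : Finset (Fin n)} {k : Fin n} (hk : k ∉ F) {N : ℕ}
    (hN : N ≠ 0) : (X k : Poly K n) ^ N ∈ facePrime K F :=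
  Ideal.pow_mem_of_mem (facePrime K F) (Ideal.subset_span ⟨k, hk, rfl⟩) N (Nat.pos_of_ne_zero hN)

/-- Saturation of `U` along the faces: the exponents of monomials in `U` can be detected after
multiplication with high powers of the adjacent variables. -/
theorem monomial_mem_of_forall_adjacent (hI : IsMonomialIdeal I) (hU : IsMonomialIdeal U)
    (hrad : I.IsRadical) (hreg : HasRegularPair I U) {a : Fin n →₀ ℕ}
    {F : Finset (Fin n)} (hF : F ∈ maxFaces I U) (haF : a.support ⊆ F)
    (h : ∀ k, (∃ G ∈ maxFaces I U, a.support ⊆ G ∧ k ∈ G) →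
      ∃ N, monomial (a + Finsupp.single k N) (1 : K) ∈ U) :
    monomial a (1 : K) ∈ U := by
  have hglue : Glues I U fun _ => monomial a (1 : K) := by
    refine glues_of_forall_X_pow hI hU hrad hreg fun k => ?_
    by_cases hk : ∃ G ∈ maxFaces I U, a.support ⊆ G ∧ k ∈ G
    · obtain ⟨N, hN⟩ := h k hk
      refine ⟨N, _, hN, fun G _ => ?_⟩
      have : (X k : Poly K n) ^ N * monomial a 1 = monomial (a + Finsupp.single k N) 1 := by
        rw [X_pow_eq_monomial, monomial_mul, one_mul, add_comm]
      rw [this, sub_self]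
      exact Ideal.zero_mem _
    -- No facet contains both `k` and the support of `a`, so `x_k x^a` vanishes modulo every `P_G`
    -- and 0 glues it.
    · refine ⟨1, 0, U.zero_mem, fun G hG => ?_⟩
      rw [zero_sub, neg_mem_iff]
      by_cases haG : a.support ⊆ G
      · exact Ideal.mul_mem_right _ _
          (X_pow_mem_facePrime (fun hkG => hk ⟨G, hG, haG, hkG⟩) one_ne_zero)
      · exact Ideal.mul_mem_left _ _ (monomial_mem_facePrime.2 haG)
  obtain ⟨u, hu, h'⟩ := hglue
  have h1 := coeff_eq_zero_of_mem_facePrime (h' F hF) haF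
  rw [coeff_sub, coeff_monomial, if_pos rfl, sub_eq_zero] at h1
  exact hU.mem_iff.1 hu a (mem_support_iff.2 (by rw [h1]; exact one_ne_zero))

/-- Connectedness: a union of connected components on which `U` contains powers of all
variables is everything. -/
theorem one_mem_of_closed (hI : IsMonomialIdeal I) (hU : IsMonomialIdeal U)
    (hrad : I.IsRadical) (hreg : HasRegularPair I U) {C : Set (Fin n)}
    (hC : ∀ i ∈ C, ∃ N, monomial (Finsupp.single i N) (1 : K) ∈ U)
    (hclosed : ∀ F ∈ maxFaces I U, ∀ i ∈ F, i ∈ C → ∀ j ∈ F, j ∈ C)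
    {F : Finset (Fin n)} (hF : F ∈ maxFaces I U) (hFC : ∀ i ∈ F, i ∈ C) :
    monomial 0 (1 : K) ∈ U ∧ ∀ G ∈ maxFaces I U, ∀ i ∈ G, i ∈ C := by
  classical
  -- The indicator of the facets inside `C` is glued; the constant term of the glued element must
  -- agree with it on all facets at once.
  have hglue : Glues I U fun G => if ∀ i ∈ G, i ∈ C then 1 else 0 := by
    refine glues_of_forall_X_pow hI hU hrad hreg fun k => ?_
    by_cases hk : k ∈ C
    · obtain ⟨N, hN⟩ := hC k hk
      -- `N` may be 0, and the power has to vanish modulo the facets outside `C`.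
      refine ⟨N + 1, X k ^ (N + 1), ?_, fun G hG => ?_⟩
      · rw [X_pow_eq_monomial]
        exact monomial_mem_of_le (Finsupp.single_mono (Nat.le_succ N)) hN
      · by_cases hGC : ∀ i ∈ G, i ∈ C
        · simp only [if_pos hGC, mul_one, sub_self]
          exact Ideal.zero_mem _
        · simp only [if_neg hGC, mul_zero, sub_zero]
          exact X_pow_mem_facePrime (fun hkG => hGC (hclosed G hG k hkG hk)) (Nat.succ_ne_zero _)
    · refine ⟨1, 0, U.zero_mem, fun G hG => ?_⟩
      rw [zero_sub, neg_mem_iff]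
      by_cases hGC : ∀ i ∈ G, i ∈ C
      · exact Ideal.mul_mem_right _ _
          (X_pow_mem_facePrime (fun hkG => hk (hGC k hkG)) one_ne_zero)
      · simp only [if_neg hGC, mul_zero]
        exact Ideal.zero_mem _
  obtain ⟨u, hu, h'⟩ := hglue
  have hcoeff : ∀ G ∈ maxFaces I U, coeff 0 u = if ∀ i ∈ G, i ∈ C then 1 else 0 := by
    intro G hG
    have h1 := coeff_eq_zero_of_mem_facePrime (h' G hG) (m := 0) (by simp)
    rw [coeff_sub, sub_eq_zero] at h1
    rw [h1]
    by_cases hGC : ∀ i ∈ G, i ∈ C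
    · simp only [if_pos hGC, coeff_zero_one]
    · simp only [if_neg hGC, coeff_zero]
  have h1 : coeff 0 u = 1 := by rw [hcoeff F hF, if_pos hFC]
  refine ⟨hU.mem_iff.1 hu 0 (mem_support_iff.2 (by rw [h1]; exact one_ne_zero)), fun G hG => ?_⟩
  by_contra hGC
  rw [hcoeff G hG, if_neg hGC] at h1
  exact zero_ne_one h1

/-- Dimension 2 bounds the size above. The empty facet would put the regular element `f` in its
prime, and a one-vertex facet would be an isolated component, hence by connectedness the only facet,
forcing dimension at most 1. -/
theorem card_eq_two_of_mem_maxFaces (hI : IsMonomialIdeal I) (hU : IsMonomialIdeal U)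
    (hrad : I.IsRadical) (hreg : HasRegularPair I U)
    (hdim : Module.supportDim (Poly K n) (Subquotient I U) = 2)
    {F : Finset (Fin n)} (hF : F ∈ maxFaces I U) : F.card = 2 := by
  rw [Module.supportDim_eq_ringKrullDim_quotient_annihilator] at hdim
  have hle : F.card ≤ 2 := by
    have := card_le_ringKrullDim (K := K)
      (J := Module.annihilator (Poly K n) (Subquotient I U)) (F := F)
      fun r hr => (annihilator_subquotient hI hU hrad).1 hr F hF
    rw [hdim] at this
    exact_mod_cast this
  have h0 : F ≠ ∅ := by
    rintro rfl
    obtain ⟨f, hf, g, -, hfreg, -⟩ := hreg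
    refine notMem_facePrime_of_regular hI hU hfreg hF ?_
    have : idealOfVars (Fin n) K ≤ facePrime K ∅ := by
      rw [Ideal.span_le]
      rintro _ ⟨k, rfl⟩
      exact Ideal.subset_span ⟨k, Finset.notMem_empty k, rfl⟩
    exact this hf
  have h1 : F.card ≠ 1 := by
    intro hcard
    obtain ⟨i, rfl⟩ := Finset.card_eq_one.1 hcard
    obtain ⟨a, ha, haU, -⟩ := (mem_maxFaces.1 hF).prop
    have hall := (one_mem_of_closed hI hU hrad hreg (C := {i}) ?_ ?_ hF
      fun j hj => by simpa using hj).2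
    · have hann : facePrime K {i} ≤ Module.annihilator (Poly K n) (Subquotient I U) := by
        intro r hr
        rw [annihilator_subquotient hI hU hrad]
        intro G hG
        have : G ⊆ {i} := fun j hj => by simpa using hall G hG j hj
        rwa [eq_of_subset_of_mem_maxFaces hG hF this]
      have := ringKrullDim_le_card hann
      rw [hdim] at this
      norm_num at this
    · rintro j rfl
      refine ⟨a j, ?_⟩
      have : a = Finsupp.single j (a j) := Finsupp.support_subset_singleton.1 ha.subset
      rwa [← this]
    · intro G hG j hj hji k hk
      obtain rfl : j = i := hji
      have := eq_of_subset_of_mem_maxFaces hF hG (Finset.singleton_subset_iff.2 hj)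
      rw [← this] at hk
      simpa using hk
  have := Finset.card_pos.2 (Finset.nonempty_iff_ne_empty.2 h0)
  omega

end Depth

/-! ### Shelling the graph of facets -/

section Shelling

theorem exists_isLeast_of_inf_mem {n : ℕ} {S : Set (Fin n →₀ ℕ)} (hne : S.Nonempty)
    (hinf : ∀ a ∈ S, ∀ b ∈ S, a ⊓ b ∈ S) : ∃ a, IsLeast S a := by
  obtain ⟨m, hm, hmin⟩ := (wellFounded_lt (α := Fin n →₀ ℕ)).has_min S hne
  refine ⟨m, hm, fun b hb => ?_⟩
  have h := hmin _ (hinf m hm b hb)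
  have h1 : m ⊓ b = m := by
    by_contra h2
    exact h (lt_of_le_of_ne inf_le_left h2)
  exact inf_eq_left.1 h1

theorem exists_other_of_card_eq_two {α : Type*} {e : Finset α} (he : e.card = 2) {i : α}
    (hi : i ∈ e) : ∃ j ∈ e, j ≠ i ∧ ∀ k ∈ e, k = i ∨ k = j := by
  classical
  obtain ⟨x, y, hxy, rfl⟩ := Finset.card_eq_two.1 he
  rcases Finset.mem_insert.1 hi with rfl | hi
  · exact ⟨y, by simp, hxy.symm, by simp⟩
  · obtain rfl := Finset.mem_singleton.1 hi
    exact ⟨x, by simp, hxy, by simp [or_comm]⟩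

variable {K : Type*} [Field K] {n : ℕ} {I U : Ideal (Poly K n)}

/-- The exponents of the monomials in `U` with support `e`. -/
def fullExponents (U : Ideal (Poly K n)) (e : Finset (Fin n)) : Set (Fin n →₀ ℕ) :=
  {a | monomial a (1 : K) ∈ U ∧ a.support = e}

/-- These exponents are closed under infimum: the only facet containing the support is `e` itself,
so saturation needs only powers of its two variables. -/
theorem exists_isLeast_fullExponents (hI : IsMonomialIdeal I) (hU : IsMonomialIdeal U)
    (hrad : I.IsRadical) (hreg : HasRegularPair I U) {e : Finset (Fin n)}
    (he : e ∈ maxFaces I U) (hcard : e.card = 2) : ∃ a, IsLeast (fullExponents U e) a := by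
  apply exists_isLeast_of_inf_mem
  · obtain ⟨a, ha, haU, -⟩ := (mem_maxFaces.1 he).prop
    exact ⟨a, haU, ha⟩
  · rintro a ⟨haU, rfl⟩ b ⟨hbU, hab⟩
    have hsupp : (a ⊓ b).support = a.support := by
      rw [Finsupp.support_inf, hab, Finset.inter_self]
    refine ⟨monomial_mem_of_forall_adjacent hI hU hrad hreg he hsupp.subset ?_, hsupp⟩
    rintro k ⟨G, hG, haG, hk⟩
    rw [hsupp] at haG
    rw [← eq_of_subset_of_mem_maxFaces he hG haG] at hk
    obtain ⟨j, hj, hjk, hall⟩ := exists_other_of_card_eq_two hcard hk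
    -- The `k`-entry now exceeds both `a k` and `b k`, so whichever of `a`, `b` is smaller at `j`
    -- lies below.
    refine ⟨a k + b k, ?_⟩
    rcases le_total (a j) (b j) with h | h
    · refine monomial_mem_of_le (fun l => ?_) haU
      by_cases hl : l ∈ a.support
      · rcases hall l hl with rfl | rfl
        · simp; omega
        · simp [h]
      · simp [Finsupp.notMem_support_iff.1 hl]
    · refine monomial_mem_of_le (fun l => ?_) hbU
      by_cases hl : l ∈ a.support
      · rcases hall l hl with rfl | rfl
        · simp; omega
        · simp [h]
      · rw [← hab] at hl
        simp [Finsupp.notMem_support_iff.1 hl]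

/-- Multiplying by the variable of the other vertex of `e` gives full support without changing the
entry at `i`. -/
theorem apply_le_of_isLeast {e : Finset (Fin n)} (hcard : e.card = 2) {q : Fin n →₀ ℕ}
    (hq : IsLeast (fullExponents U e) q) {b : Fin n →₀ ℕ} (hb : monomial b (1 : K) ∈ U)
    (hbe : b.support ⊆ e) {i : Fin n} (hi : i ∈ b.support) : q i ≤ b i := by
  obtain ⟨j, hj, hji, hall⟩ := exists_other_of_card_eq_two hcard (hbe hi)
  have hmem : b + Finsupp.single j 1 ∈ fullExponents U e := by
    refine ⟨monomial_mem_of_le le_self_add hb, ?_⟩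
    ext k
    simp only [Finsupp.mem_support_iff, Finsupp.add_apply]
    constructor
    · intro h
      by_cases hk : b k = 0
      · by_cases hkj : k = j
        · exact hkj ▸ hj
        · simp [hk, Ne.symm hkj] at h
      · exact hbe (Finsupp.mem_support_iff.2 hk)
    · intro h
      rcases hall k h with rfl | rfl
      · have := Finsupp.mem_support_iff.1 hi
        omega
      · simp
  have := hq.2 hmem i
  simpa [Finsupp.single_apply, hji] using this

theorem pos_of_isLeast {e : Finset (Fin n)} {q : Fin n →₀ ℕ}
    (hq : IsLeast (fullExponents U e) q) {i : Fin n} (hi : i ∈ e) : q i ≠ 0 := by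
  rw [← hq.1.2] at hi
  exact Finsupp.mem_support_iff.1 hi

/-- Choose `e'` through `i` with `q e' i` maximal. For every edge `G = {i, k}`, the power `x_i ^ (q
e' i)` times `x_k ^ (q G k)` is then a multiple of `x ^ (q G)`, so saturation applies. -/
theorem exists_single_mem (hI : IsMonomialIdeal I) (hU : IsMonomialIdeal U)
    (hrad : I.IsRadical) (hreg : HasRegularPair I U)
    (hcard : ∀ e ∈ maxFaces I U, e.card = 2) {q : Finset (Fin n) → Fin n →₀ ℕ}
    (hq : ∀ e ∈ maxFaces I U, IsLeast (fullExponents U e) (q e)) {i : Fin n} {N : ℕ}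
    (hN : monomial (Finsupp.single i N) (1 : K) ∈ U) {e : Finset (Fin n)}
    (he : e ∈ maxFaces I U) (hi : i ∈ e) :
    ∃ e' ∈ maxFaces I U, i ∈ e' ∧ monomial (Finsupp.single i (q e' i)) (1 : K) ∈ U := by
  obtain ⟨e', ⟨he', hie'⟩, hmax⟩ := Set.exists_max_image {e | e ∈ maxFaces I U ∧ i ∈ e}
    (fun e => q e i) (Set.toFinite _) ⟨e, he, hi⟩
  refine ⟨e', he', hie', monomial_mem_of_forall_adjacent hI hU hrad hreg he' ?_ ?_⟩
  · exact Finsupp.support_single_subset.trans (Finset.singleton_subset_iff.2 hie')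
  · rintro k ⟨G, hG, hsub, hk⟩
    rw [Finsupp.support_single _ (pos_of_isLeast (hq e' he') hie'),
      Finset.singleton_subset_iff] at hsub
    by_cases hki : k = i
    · subst hki
      exact ⟨N, monomial_mem_of_le le_add_self hN⟩
    · refine ⟨q G k, monomial_mem_of_le (fun l => ?_) (hq G hG).1.1⟩
      by_cases hl : l ∈ G
      · obtain ⟨j, hj, hji, hall⟩ := exists_other_of_card_eq_two (hcard G hG) hsub
        have hkj := (hall k hk).resolve_left hki
        rcases hall l hl with rfl | rfl
        · have := hmax G ⟨hG, hsub⟩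
          simp only [Finsupp.add_apply, Finsupp.single_eq_same]
          omega
        · simp [hkj]
      · have : q G l = 0 := by
          rw [← (hq G hG).1.2] at hl
          exact Finsupp.notMem_support_iff.1 hl
        simp [this]

/-- Call a vertex new if a power of its variable lies in `U` and no edge of `L` contains it. An edge
is suitable if it is missing and has no new vertex, or if it has exactly one new vertex `w` and `x_w
^ (q e w)` lies in `U`. If neither kind exists, the new vertices form a union of components, and
connectedness makes every vertex new and puts 1 in `U`, which leaves only the case of empty `L`. -/
theorem exists_isLeast_newExponents (hI : IsMonomialIdeal I) (hU : IsMonomialIdeal U)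
    (hrad : I.IsRadical) (hreg : HasRegularPair I U)
    (hcard : ∀ e ∈ maxFaces I U, e.card = 2) {L : List (Finset (Fin n))}
    (hL : ∀ e ∈ L, e ∈ maxFaces I U) (hmiss : ∃ e ∈ maxFaces I U, e ∉ L) :
    ∃ e ∈ maxFaces I U, e ∉ L ∧ ∃ a, IsLeast (newExponents U e L) a := by
  obtain ⟨e₀, he₀, he₀L⟩ := hmiss
  by_cases h0 : L = [] ∧ monomial 0 (1 : K) ∈ U
  · obtain ⟨rfl, h0⟩ := h0
    exact ⟨e₀, he₀, he₀L, 0, ⟨h0, by simp, by simp⟩, fun a _ => zero_le⟩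
  have hex : ∀ e, ∃ q, e ∈ maxFaces I U → IsLeast (fullExponents U e) q := by
    intro e
    by_cases he : e ∈ maxFaces I U
    · obtain ⟨q, hq⟩ := exists_isLeast_fullExponents hI hU hrad hreg he (hcard e he)
      exact ⟨q, fun _ => hq⟩
    · exact ⟨0, fun h => absurd h he⟩
  choose q hq using hex
  let new : Set (Fin n) := {i | (∃ N, monomial (Finsupp.single i N) (1 : K) ∈ U) ∧
    ∀ e ∈ L, i ∉ e}
  have mem_new : ∀ i, i ∈ new ↔ (∃ N, monomial (Finsupp.single i N) (1 : K) ∈ U) ∧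
    ∀ e ∈ L, i ∉ e := fun i => Iff.rfl
  have hnew : ∀ (e : Finset (Fin n)) (a : Fin n →₀ ℕ) (j : Fin n), a ∈ newExponents U e L →
      a.support ⊆ {j} → j ∈ new := by
    intro e a j ha haj
    have h1 : a = Finsupp.single j (a j) := Finsupp.support_subset_singleton.1 haj
    refine (mem_new j).2 ⟨⟨a j, h1 ▸ ha.1⟩, fun e' he' hj => ha.2.2 e' he' ?_⟩
    exact haj.trans (Finset.singleton_subset_iff.2 hj)
  have hother : ∀ (e : Finset (Fin n)) (a : Fin n →₀ ℕ) (i : Fin n), e ∈ maxFaces I U → i ∈ e →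
      a ∈ newExponents U e L → a i = 0 → ∃ j ∈ e, j ≠ i ∧ j ∈ new := by
    intro e a i he hi ha hai
    obtain ⟨j, hj, hji, hall⟩ := exists_other_of_card_eq_two (hcard e he) hi
    refine ⟨j, hj, hji, hnew e a j ha fun k hk => ?_⟩
    rw [Finset.mem_singleton]
    refine (hall k (ha.2.1 hk)).resolve_left ?_
    rintro rfl
    exact Finsupp.mem_support_iff.1 hk hai
  -- Without new vertices, every exponent in `newExponents` has full support, so `q e` is least.
  by_cases hA : ∃ e ∈ maxFaces I U, e ∉ L ∧ ∀ i ∈ e, i ∉ new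
  · obtain ⟨e, he, heL, hnone⟩ := hA
    have hqe := hq e he
    refine ⟨e, he, heL, q e, ⟨hqe.1.1, hqe.1.2.subset, fun e' he' h => heL ?_⟩, fun a ha => ?_⟩
    · rw [hqe.1.2] at h
      rwa [eq_of_subset_of_mem_maxFaces he (hL e' he') h]
    · refine hqe.2 ⟨ha.1, ha.2.1.antisymm fun i hi => ?_⟩
      rw [Finsupp.mem_support_iff]
      intro hai
      obtain ⟨j, hj, -, hjn⟩ := hother e a i he hi ha hai
      exact hnone j hj hjn
  -- Every exponent in `newExponents` involves `w`, since otherwise the other vertex would be new as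
  -- well.
  by_cases hB : ∃ e ∈ maxFaces I U, ∃ w ∈ e, w ∈ new ∧ (∀ j ∈ e, j ≠ w → j ∉ new) ∧
      monomial (Finsupp.single w (q e w)) (1 : K) ∈ U
  · obtain ⟨e, he, w, hw, hwn, hnone, hwU⟩ := hB
    have hqe := hq e he
    have hwL := ((mem_new w).1 hwn).2
    refine ⟨e, he, fun h => hwL e h hw, Finsupp.single w (q e w), ⟨hwU, ?_, ?_⟩, ?_⟩
    · exact Finsupp.support_single_subset.trans (Finset.singleton_subset_iff.2 hw)
    · intro e' he' h
      rw [Finsupp.support_single _ (pos_of_isLeast hqe hw), Finset.singleton_subset_iff] at h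
      exact hwL e' he' h
    · intro a ha
      rw [Finsupp.single_le_iff]
      by_cases haw : a w = 0
      · obtain ⟨j, hj, hjw, hjn⟩ := hother e a w he hw ha haw
        exact absurd hjn (hnone j hj hjw)
      · exact apply_le_of_isLeast (hcard e he) hqe ha.1 ha.2.1 (Finsupp.mem_support_iff.2 haw)
  exfalso
  push Not at hA hB
  have hclosed : ∀ F ∈ maxFaces I U, ∀ i ∈ F, i ∈ new → ∀ j ∈ F, j ∈ new := by
    intro F hF i hi hin j hj
    by_contra hjn
    have hFi : ∀ k ∈ F, k ≠ i → k ∉ new := by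
      intro k hk hki
      obtain ⟨j', -, -, hall⟩ := exists_other_of_card_eq_two (hcard F hF) hi
      have h1 := (hall k hk).resolve_left hki
      have h2 := (hall j hj).resolve_left fun h => hjn (h ▸ hin)
      rwa [h1, ← h2]
    obtain ⟨N, hN⟩ := ((mem_new i).1 hin).1
    obtain ⟨e', he', hie', hU'⟩ := exists_single_mem hI hU hrad hreg hcard hq hN hF hi
    obtain ⟨k, hk, hki, hall⟩ := exists_other_of_card_eq_two (hcard e' he') hie'
    by_cases hkn : k ∈ new
    · obtain ⟨M, hM⟩ := ((mem_new k).1 hkn).1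
      -- As `x_k ^ M * x_i` lies in `U`, the entry `q e' i` is at most 1. So `x_i` itself lies in
      -- `U`, and `F`, whose only new vertex is `i`, contradicts `hB`.
      have h1 : q e' i ≤ (Finsupp.single k M + Finsupp.single i 1 : Fin n →₀ ℕ) i := by
        refine apply_le_of_isLeast (hcard e' he') (hq e' he')
          (monomial_mem_of_le le_self_add hM) ?_ ?_
        · refine Finsupp.support_add.trans (Finset.union_subset ?_ ?_)
          · exact Finsupp.support_single_subset.trans (Finset.singleton_subset_iff.2 hk)
          · exact Finsupp.support_single_subset.trans (Finset.singleton_subset_iff.2 hie')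
        · simp
      have h2 : q e' i ≤ 1 := by simpa [Finsupp.single_apply, hki] using h1
      have h3 := pos_of_isLeast (hq F hF) hi
      exact hB F hF i hi hin hFi (monomial_mem_of_le (Finsupp.single_mono (by omega)) hU')
    · refine hB e' he' i hie' hin (fun j' hj' hj'i => ?_) hU'
      rwa [(hall j' hj').resolve_left hj'i]
  obtain ⟨i₀, hi₀, hi₀n⟩ := hA e₀ he₀ he₀L
  obtain ⟨h1, h2⟩ := one_mem_of_closed hI hU hrad hreg (C := new)
    (fun i hi => ((mem_new i).1 hi).1) hclosed he₀ (hclosed e₀ he₀ i₀ hi₀ hi₀n)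
  obtain ⟨e, he⟩ := List.exists_mem_of_ne_nil L fun h => h0 ⟨h, h1⟩
  have hpos : 0 < e.card := by rw [hcard e (hL e he)]; norm_num
  obtain ⟨i, hi⟩ := Finset.card_pos.1 hpos
  exact ((mem_new i).1 (h2 e (hL e he) i hi)).2 e he hi

/-- Greedy choice, by induction on the number of missing elements. Each choice is put at the head,
so `L.drop (k + 1)` is the list that was present when `L[k]` was chosen. -/
theorem exists_shelling {α : Type*} [Finite α] {E : Set α} {good : α → List α → Prop}
    (h : ∀ L : List α, (∀ e ∈ L, e ∈ E) → (∃ e ∈ E, e ∉ L) → ∃ e ∈ E, e ∉ L ∧ good e L) :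
    ∃ L : List α, (∀ e, e ∈ L ↔ e ∈ E) ∧
      ∀ (k : ℕ) (hk : k < L.length), good L[k] (L.drop (k + 1)) := by
  suffices key : ∀ (m : ℕ) (L : List α), (∀ e ∈ L, e ∈ E) →
      (∀ (k : ℕ) (hk : k < L.length), good L[k] (L.drop (k + 1))) →
      (E \ {e | e ∈ L}).ncard = m →
      ∃ L : List α, (∀ e, e ∈ L ↔ e ∈ E) ∧
        ∀ (k : ℕ) (hk : k < L.length), good L[k] (L.drop (k + 1)) by
    exact key _ [] (by simp) (fun k hk => absurd hk (Nat.not_lt_zero k)) rfl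
  intro m
  induction m using Nat.strong_induction_on with
  | _ m ih =>
    intro L hLE hL hm
    by_cases hmiss : ∃ e ∈ E, e ∉ L
    · obtain ⟨e, heE, heL, hgood⟩ := h L hLE hmiss
      refine ih _ ?_ (e :: L) (List.forall_mem_cons.2 ⟨heE, hLE⟩) ?_ rfl
      · rw [← hm]
        refine Set.ncard_lt_ncard ⟨fun x hx => ⟨hx.1, fun hxL => hx.2 ?_⟩, fun hsub => ?_⟩
          (Set.toFinite _)
        · exact List.mem_cons_of_mem _ hxL
        · exact (hsub ⟨heE, heL⟩).2 List.mem_cons_self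
      · rintro (_ | k) hk
        · exact hgood
        · exact hL k (Nat.lt_of_succ_lt_succ hk)
    · push Not at hmiss
      exact ⟨L, fun e => ⟨hLE e, hmiss e⟩, hL⟩

end Shelling

end Multigraded

/-! ### Cleanness of `U/I` -/

theorem mainTheorem6 {K : Type*} [Field K] {n : ℕ}
    (I U : Ideal (Multigraded.Poly K n))
    (hI : Multigraded.IsMonomialIdeal I) (hU : Multigraded.IsMonomialIdeal U) (hIU : I ≤ U)
    (hCM : Multigraded.IsCohenMacaulay K n (Multigraded.Subquotient I U))
    (hdim : Module.supportDim (Multigraded.Poly K n) (Multigraded.Subquotient I U) = 2)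
    (hred : I.IsRadical) :
    Multigraded.IsClean K (Multigraded.subquotientGrading I U) := by
  have hdepth : Multigraded.depth K n (Multigraded.Subquotient I U) = 2 := by
    rcases hCM with h | h
    · rw [Module.supportDim_eq_bot_of_subsingleton] at hdim
      exact absurd hdim.symm WithBot.coe_ne_bot
    · rw [hdim] at h
      exact WithBot.coe_injective h
  have hreg : Multigraded.HasRegularPair I U := Multigraded.hasRegularPair_of_depth_eq_two hdepth
  obtain ⟨L, hL, hleast⟩ := Multigraded.exists_shelling fun L hL hmiss =>
    Multigraded.exists_isLeast_newExponents hI hU hred hreg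
      (fun _ he => Multigraded.card_eq_two_of_mem_maxFaces hI hU hred hreg hdim he) hL hmiss
  refine ⟨L.length, _, _, Multigraded.isPrimeFiltration_faceInter hI hU hred hIU hL hleast, ?_⟩
  rw [Multigraded.minimalPrimes_annihilator_subquotient hI hU hred]
  ext Q
  constructor
  · rintro ⟨k, rfl⟩
    exact ⟨L[k], (hL _).1 (List.getElem_mem _), rfl⟩
  · rintro ⟨F, hF, rfl⟩
    obtain ⟨k, hk, rfl⟩ := List.getElem_of_mem ((hL F).2 hF)
    exact ⟨⟨k, hk⟩, rfl⟩
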